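/- Let $\mathbf Q$ be the class of functions $q:[0,1]\to[0,1]$ with $q\in C^2([0,1])$ and $|q^{(i)}(x)|\le 1$ for $i=0,1,2$ and all $x\in[0,1]$, and let $\|f\|_\infty=\max_{x\in[0,1]}|f(x)|$. For $q\in\mathbf Q$ let $\lambda(q)$ be the smallest eigenvalue of the Sturm–Liouville problem $$-u''(x)+q(x)u(x)=\lambda u(x)\quad (0<x<1),\qquad u(0)=u(1)=0,\qquad 0\ne u\in C^2([0,1]),$$ and let $u_q$ be a real eigenfunction for $\lambda(q)$ normalized by $\int_0^1u_q(x)^2\,dx=1$. Then, for every $q\in\mathbf Q$, the smallest eigenvalue $\lambda(q)$ exists, and $u_q$ exists and is unique up to its sign. Moreover: 1. For all $q,\bar q\in\mathbf Q$, $|\lambda(q)-\lambda(\bar q)|\le\|q-\bar q\|_\infty$. 2. The signs of the functions $u_q$, $q\in\mathbf Q$, can be chosen so that, with a constant $C_1$ independent of $q$ and $\bar q$, $\|u_q-u_{\bar q}\|_\infty\le C_1\|q-\bar q\|_\infty$ for all $q,\bar q\in\mathbf Q$. 3. There is a constant $C_2$ such that for all $q,\bar q\in\mathbf Q$ (and either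 choice of the sign of $u_{\bar q}$) $$\Big|\lambda(q)-\lambda(\bar q)-\int_0^1\big(q(x)-\bar q(x)\big)u_{\bar q}(x)^2\,dx\Big|\le C_2\|q-\bar q\|_\infty^2 .$$ 4. There is a constant $C_3$ such that for all $q\in\mathbf Q$ $$\Big|\lambda(q)-\pi^2-\tfrac12-2\int_0^1\big(q(x)-\tfrac12\big)\sin^2(\pi x)\,dx\Big|\le C_3\big\|q-\tfrac12\big\|_\infty^2 .$$ -/

import Mathlib

namespace SturmLiouville

/-- The class `Q`: functions `q : [0,1] → [0,1]` of class `C²([0,1])` (one-sided derivatives at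
the end points) with `|q^{(i)}(x)| ≤ 1` for `i = 0, 1, 2` and `x ∈ [0,1]`. Functions on `[0,1]`
are represented by functions on `ℝ` of which only the values on `[0,1]` matter. -/
def Q : Set (ℝ → ℝ) :=
  {q | Set.MapsTo q (Set.Icc 0 1) (Set.Icc 0 1) ∧
    ContDiffOn ℝ 2 q (Set.Icc 0 1) ∧
    ∀ i : ℕ, i ≤ 2 → ∀ x ∈ Set.Icc (0 : ℝ) 1,
      |iteratedDerivWithin i q (Set.Icc 0 1) x| ≤ 1}

/-- The sup norm `max_{x ∈ [0,1]} |f x|`. -/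
noncomputable def supNorm (f : ℝ → ℝ) : ℝ :=
  ⨆ x : Set.Icc (0 : ℝ) 1, |f x|

/-- The differential expression `(L_q u)(x) = -u''(x) + q(x) u(x)`. -/
noncomputable def L (q u : ℝ → ℝ) (x : ℝ) : ℝ :=
  -(deriv (deriv u) x) + q x * u x

/-- `u ∈ C²([0,1])` is non-zero on `[0,1]`, `L_q u = μ u` on `(0,1)` and `u(0) = u(1) = 0`. -/
structure IsEigenfunction (q : ℝ → ℝ) (μ : ℝ) (u : ℝ → ℝ) : Prop where
  contDiffOn : ContDiffOn ℝ 2 u (Set.Icc 0 1)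
  nonzero : ∃ x ∈ Set.Icc (0 : ℝ) 1, u x ≠ 0
  equation : ∀ x ∈ Set.Ioo (0 : ℝ) 1, L q u x = μ * u x
  left : u 0 = 0
  right : u 1 = 0

/-- The set of (real) eigenvalues of the Dirichlet problem for `L_q`. -/
def eigenvalues (q : ℝ → ℝ) : Set ℝ :=
  {μ | ∃ u, IsEigenfunction q μ u}

/-- The smallest eigenvalue `λ(q)`. -/
noncomputable def smallestEigenvalue (q : ℝ → ℝ) : ℝ :=
  sInf (eigenvalues q)

/-- `u` is an `L₂`-normalized real eigenfunction for the smallest eigenvalue of `L_q`. -/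
def IsGroundState (q u : ℝ → ℝ) : Prop :=
  IsEigenfunction q (smallestEigenvalue q) u ∧ ∫ x in (0 : ℝ)..1, u x ^ 2 = 1

end SturmLiouville

/-! Everything is read off the initial value problem y'' = (q - μ) y, y(0) = 0, y'(0) = 1. Solutions
with y(0) = 0 are unique up to a factor, so μ is an eigenvalue exactly when this solution vanishes
at 1. At the least μ for which it has a zero in (0,1], that zero sits at 1; this gives the smallest
eigenvalue and an eigenfunction positive on (0,1) (`exists_least_parameter`), without any
variational principle.

For two positive solutions with coefficients a and b the boundary terms of the Wronskian vanish, so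
∫ (a - b) y w = 0 (`IsSolution.wronskian`). Hence a - b cannot be strictly of one sign, which is the
eigenvalue bound (`abs_smallestEigenvalue_sub_le`). Grönwall's inequality then makes y Lipschitz in
q, and a uniform lower bound for its norm (`normBound_le`) carries this over to the normalized
positive eigenfunctions. For these, the identity says (λ(q) - λ(p)) ∫ u w = ∫ (q - p) u w; replacing
u by w costs only a second order error. -/

namespace SturmLiouville

open Set

/-! ### The initial value problem: existence, bounds, zeros. -/

/-- `y'' = a y` on `[0,1]` with `y' = z` and `y(0) = 0`. -/
structure IsSolution (a y z : ℝ → ℝ) : Prop where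
  hasDeriv_fst : ∀ x ∈ Icc (0 : ℝ) 1, HasDerivWithinAt y (z x) (Icc 0 1) x
  hasDeriv_snd : ∀ x ∈ Icc (0 : ℝ) 1, HasDerivWithinAt z (a x * y x) (Icc 0 1) x
  zero : y 0 = 0

/-- Grönwall's inequality for the first order system of a second order equation. -/
lemma gronwall_pair {y y' z z' : ℝ → ℝ} {δ K ε : ℝ} (hδ : 0 ≤ δ) (hK : 1 ≤ K) (hε : 0 ≤ ε)
    (hy : ∀ x ∈ Icc (0 : ℝ) 1, HasDerivWithinAt y (y' x) (Icc 0 1) x)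
    (hz : ∀ x ∈ Icc (0 : ℝ) 1, HasDerivWithinAt z (z' x) (Icc 0 1) x)
    (hy' : ∀ x ∈ Icc (0 : ℝ) 1, |y' x| ≤ |z x|)
    (hz' : ∀ x ∈ Icc (0 : ℝ) 1, |z' x| ≤ K * |y x| + ε)
    (hy0 : |y 0| ≤ δ) (hz0 : |z 0| ≤ δ) {x : ℝ} (hx : x ∈ Icc (0 : ℝ) 1) :
    |y x| ≤ (δ + ε) * Real.exp K ∧ |z x| ≤ (δ + ε) * Real.exp K := by
  have key := norm_le_gronwallBound_of_norm_deriv_right_le (f := fun x => (y x, z x))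
    (f' := fun x => (y' x, z' x)) (δ := δ) (K := K) (ε := ε) (a := 0) (b := 1)
    (fun x hx => ((hy x hx).prodMk (hz x hx)).continuousWithinAt)
    (fun x hx => by
      have hx' : x ∈ Icc (0 : ℝ) 1 := Ico_subset_Icc_self hx
      refine ((hy x hx').prodMk (hz x hx')).mono_of_mem_nhdsWithin ?_
      exact Filter.mem_of_superset (Icc_mem_nhdsGE hx.2) (Icc_subset_Icc_left hx.1))
    (by simpa [Prod.norm_def] using ⟨hy0, hz0⟩)
    (fun x hx => by
      have hx' : x ∈ Icc (0 : ℝ) 1 := Ico_subset_Icc_self hx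
      have h1 := hy' x hx'
      have h2 := hz' x hx'
      simp only [Prod.norm_def, Real.norm_eq_abs]
      have h3 : K * |y x| ≤ K * max |y x| |z x| := by gcongr; exact le_max_left _ _
      have h4 : |z x| ≤ max |y x| |z x| := le_max_right _ _
      have h5 : max |y x| |z x| ≤ K * max |y x| |z x| :=
        le_mul_of_one_le_left ((abs_nonneg _).trans h4) hK
      exact max_le (by linarith) (by linarith)) x hx
  have hb : gronwallBound δ K ε (x - 0) ≤ (δ + ε) * Real.exp K := by
    refine (gronwallBound_mono hδ hε (by linarith) (show x - 0 ≤ 1 by linarith [hx.2])).trans ?_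
    rw [gronwallBound_of_K_ne_0 (by linarith)]
    -- The Grönwall bound at 1 is δ e^K + (ε / K)(e^K - 1), and 1 ≤ K.
    have h1 : ε / K ≤ ε := div_le_self hε hK
    have h2 : 0 ≤ Real.exp K - 1 := by linarith [Real.add_one_le_exp K]
    simp only [mul_one]
    nlinarith [mul_le_mul_of_nonneg_right h1 h2]
  have := key.trans hb
  simpa [Prod.norm_def] using this

/-- Truncation at height `M`. -/
def clamp (M x : ℝ) : ℝ := max (-M) (min x M)

lemma abs_clamp_le {M : ℝ} (hM : 0 ≤ M) (x : ℝ) : |clamp M x| ≤ M := by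
  unfold clamp; rw [abs_le]; constructor <;> grind

lemma abs_clamp_le_abs {M : ℝ} (hM : 0 ≤ M) (x : ℝ) : |clamp M x| ≤ |x| := by
  unfold clamp; grind

lemma clamp_eq_self {M x : ℝ} (h : |x| ≤ M) : clamp M x = x := by
  unfold clamp; grind

lemma abs_clamp_sub_le (M x y : ℝ) : |clamp M x - clamp M y| ≤ |x - y| := by
  unfold clamp; grind

/-- Picard–Lindelöf on all of [0,1] needs a bounded field, which a linear one is not. Truncated at
height exp K, the field is bounded by K exp K, the radius of the ball used. Grönwall bounds the
resulting solution by exp K, so the truncation never acts on it. -/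
lemma exists_isSolution {a : ℝ → ℝ} (ha : ContinuousOn a (Icc 0 1)) :
    ∃ y z, IsSolution a y z ∧ z 0 = 1 := by
  obtain ⟨K₀, hK₀⟩ := isCompact_Icc.exists_bound_of_continuousOn ha
  simp only [Real.norm_eq_abs] at hK₀
  obtain ⟨K, hK1, hK⟩ : ∃ K : ℝ, 1 ≤ K ∧ ∀ x ∈ Icc (0 : ℝ) 1, |a x| ≤ K :=
    ⟨max 1 K₀, le_max_left _ _, fun x hx => (hK₀ x hx).trans (le_max_right _ _)⟩
  have hK0 : 0 ≤ K := by linarith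
  set M : ℝ := Real.exp K with hMdef
  have hM : 0 ≤ M := (Real.exp_pos _).le
  let f : ℝ → ℝ × ℝ → ℝ × ℝ := fun t p => (clamp M p.2, a t * clamp M p.1)
  have hf : IsPicardLindelof f (⟨0, by simp⟩ : Icc (0 : ℝ) 1) ((0 : ℝ), (1 : ℝ))
      ⟨K * M, by positivity⟩ 0 ⟨K * M, by positivity⟩ ⟨K, hK0⟩ := by
    refine ⟨fun t ht => ?_, fun p _ => ?_, fun t ht p _ => ?_, ?_⟩
    · refine LipschitzOnWith.of_dist_le_mul fun p _ r _ => ?_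
      rw [Prod.dist_eq, Prod.dist_eq]
      simp only [Real.dist_eq, f, ← mul_sub, abs_mul]
      have h1 := abs_clamp_sub_le M p.2 r.2
      have h2 := abs_clamp_sub_le M p.1 r.1
      have h3 : |p.2 - r.2| ≤ max |p.1 - r.1| |p.2 - r.2| := le_max_right _ _
      have h4 : |p.1 - r.1| ≤ max |p.1 - r.1| |p.2 - r.2| := le_max_left _ _
      refine max_le ?_ ?_
      · exact (h1.trans h3).trans (le_mul_of_one_le_left ((abs_nonneg _).trans h3) hK1)
      · exact mul_le_mul (hK t ht) (h2.trans h4) (abs_nonneg _) hK0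
    · exact continuousOn_const.prodMk (ha.mul continuousOn_const)
    · simp only [Prod.norm_def, Real.norm_eq_abs, f, abs_mul]
      refine max_le ?_ ?_
      · exact (abs_clamp_le hM _).trans (le_mul_of_one_le_left hM hK1)
      · exact mul_le_mul (hK t ht) (abs_clamp_le hM _) (abs_nonneg _) hK0
    · simp
  obtain ⟨α, hα0, hα⟩ := hf.exists_eq_forall_mem_Icc_hasDerivWithinAt₀
  have h1 : ∀ x ∈ Icc (0 : ℝ) 1,
      HasDerivWithinAt (fun t => (α t).1) (clamp M (α x).2) (Icc 0 1) x :=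
    fun x hx => (hα x hx).fst
  have h2 : ∀ x ∈ Icc (0 : ℝ) 1,
      HasDerivWithinAt (fun t => (α t).2) (a x * clamp M (α x).1) (Icc 0 1) x :=
    fun x hx => (hα x hx).snd
  have hα0 : α 0 = (0, 1) := hα0
  have hb := fun x (hx : x ∈ Icc (0 : ℝ) 1) => gronwall_pair zero_le_one hK1 le_rfl h1 h2
    (fun x _ => abs_clamp_le_abs hM _)
    (fun x hx => by
      rw [abs_mul, add_zero]
      exact mul_le_mul (hK x hx) (abs_clamp_le_abs hM _) (abs_nonneg _) hK0)
    (by simp [hα0]) (by simp [hα0]) hx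
  simp only [add_zero, one_mul, ← hMdef] at hb
  refine ⟨fun t => (α t).1, fun t => (α t).2, ⟨fun x hx => ?_, fun x hx => ?_, ?_⟩, ?_⟩
  · simpa [clamp_eq_self (hb x hx).2] using h1 x hx
  · simpa [clamp_eq_self (hb x hx).1] using h2 x hx
  · simp [hα0]
  · simp [hα0]

namespace IsSolution

variable {a b y z w v : ℝ → ℝ} {K : ℝ}

lemma continuousOn_fst (h : IsSolution a y z) : ContinuousOn y (Icc 0 1) :=
  fun x hx => (h.hasDeriv_fst x hx).continuousWithinAt

lemma continuousOn_snd (h : IsSolution a y z) : ContinuousOn z (Icc 0 1) :=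
  fun x hx => (h.hasDeriv_snd x hx).continuousWithinAt

lemma hasDerivAt_fst (h : IsSolution a y z) {x : ℝ} (hx : x ∈ Ioo (0 : ℝ) 1) :
    HasDerivAt y (z x) x :=
  (h.hasDeriv_fst x (Ioo_subset_Icc_self hx)).hasDerivAt (Icc_mem_nhds hx.1 hx.2)

lemma hasDerivAt_snd (h : IsSolution a y z) {x : ℝ} (hx : x ∈ Ioo (0 : ℝ) 1) :
    HasDerivAt z (a x * y x) x :=
  (h.hasDeriv_snd x (Ioo_subset_Icc_self hx)).hasDerivAt (Icc_mem_nhds hx.1 hx.2)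

lemma const_mul (h : IsSolution a y z) (c : ℝ) :
    IsSolution a (fun x => c * y x) (fun x => c * z x) where
  hasDeriv_fst x hx := (h.hasDeriv_fst x hx).const_mul c
  hasDeriv_snd x hx := by
    have := (h.hasDeriv_snd x hx).const_mul c
    rwa [mul_left_comm] at this
  zero := by simp [h.zero]

lemma abs_le (h : IsSolution a y z) (hz : z 0 = 1) (hK1 : 1 ≤ K)
    (hK : ∀ x ∈ Icc (0 : ℝ) 1, |a x| ≤ K) {x : ℝ} (hx : x ∈ Icc (0 : ℝ) 1) :
    |y x| ≤ Real.exp K ∧ |z x| ≤ Real.exp K := by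
  have := gronwall_pair zero_le_one hK1 le_rfl h.hasDeriv_fst h.hasDeriv_snd
    (fun x _ => le_rfl)
    (fun x hx => by
      rw [abs_mul, add_zero]
      exact mul_le_mul_of_nonneg_right (hK x hx) (abs_nonneg _))
    (by simp [h.zero]) (by simp [hz]) hx
  simpa using this

/-- The difference y - w satisfies the equation for a with forcing (a - b) w and zero initial data,
and |w| ≤ exp K. -/
lemma abs_sub_le (h : IsSolution a y z) (h' : IsSolution b w v) (hz : z 0 = 1) (hv : v 0 = 1)
    (hK1 : 1 ≤ K) (hK : ∀ x ∈ Icc (0 : ℝ) 1, |a x| ≤ K)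
    (hK' : ∀ x ∈ Icc (0 : ℝ) 1, |b x| ≤ K) {ε : ℝ} (hε : 0 ≤ ε)
    (hab : ∀ x ∈ Icc (0 : ℝ) 1, |a x - b x| ≤ ε) {x : ℝ} (hx : x ∈ Icc (0 : ℝ) 1) :
    |y x - w x| ≤ Real.exp K ^ 2 * ε := by
  have := gronwall_pair (y := fun x => y x - w x) (z := fun x => z x - v x) le_rfl hK1
    (ε := ε * Real.exp K) (by positivity)
    (fun x hx => (h.hasDeriv_fst x hx).sub (h'.hasDeriv_fst x hx))
    (fun x hx => (h.hasDeriv_snd x hx).sub (h'.hasDeriv_snd x hx))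
    (fun x _ => le_rfl)
    (fun x hx => by
      have e : a x * y x - b x * w x = a x * (y x - w x) + (a x - b x) * w x := by ring
      rw [e]
      refine (abs_add_le _ _).trans ?_
      rw [abs_mul, abs_mul]
      exact add_le_add (mul_le_mul_of_nonneg_right (hK x hx) (abs_nonneg _))
        (mul_le_mul (hab x hx) (h'.abs_le hv hK1 hK' hx).1 (abs_nonneg _) hε))
    (by simp [h.zero, h'.zero]) (by simp [hz, hv]) hx
  calc |y x - w x| ≤ _ := this.1
    _ = _ := by ring

lemma eqOn_smul (ha : ContinuousOn a (Icc 0 1)) (h : IsSolution a y z) (hz : z 0 = 1)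
    (h' : IsSolution a w v) {x : ℝ} (hx : x ∈ Icc (0 : ℝ) 1) : w x = v 0 * y x := by
  obtain ⟨K₀, hK₀⟩ := isCompact_Icc.exists_bound_of_continuousOn ha
  simp only [Real.norm_eq_abs] at hK₀
  have := gronwall_pair (y := fun x => w x - v 0 * y x) (z := fun x => v x - v 0 * z x)
    (δ := 0) (ε := 0) (K := max 1 K₀) le_rfl (le_max_left _ _) le_rfl
    (fun x hx => (h'.hasDeriv_fst x hx).sub ((h.const_mul (v 0)).hasDeriv_fst x hx))
    (fun x hx => (h'.hasDeriv_snd x hx).sub ((h.const_mul (v 0)).hasDeriv_snd x hx))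
    (fun x _ => le_rfl)
    (fun x hx => by
      rw [← mul_sub, abs_mul, add_zero]
      exact mul_le_mul_of_nonneg_right ((hK₀ x hx).trans (le_max_right _ _)) (abs_nonneg _))
    (by simp [h.zero, h'.zero]) (by simp [hz]) hx
  have h2 : |w x - v 0 * y x| ≤ 0 := by simpa using this.1
  linarith [abs_nonpos_iff.1 h2]

/-- Since |z'| ≤ K exp K and z(0) = 1, the slope stays above 1/2 on this range. The range depends on
K only, which makes the later bounds uniform over `Q`. -/
lemma half_le (h : IsSolution a y z) (hz : z 0 = 1) (hK1 : 1 ≤ K)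
    (hK : ∀ x ∈ Icc (0 : ℝ) 1, |a x| ≤ K) {x : ℝ} (hx : x ∈ Icc (0 : ℝ) 1)
    (hx' : K * Real.exp K * x ≤ 1 / 2) : x / 2 ≤ y x := by
  have hKe : 0 < K * Real.exp K := by positivity
  have hzx : ∀ t ∈ Icc (0 : ℝ) x, 1 / 2 ≤ z t := by
    intro t ht
    have ht1 : t ∈ Icc (0 : ℝ) 1 := ⟨ht.1, ht.2.trans hx.2⟩
    have := (convex_Icc (0 : ℝ) 1).norm_image_sub_le_of_norm_hasDerivWithin_le
      (f := z) (C := K * Real.exp K) h.hasDeriv_snd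
      (fun s hs => by
        rw [Real.norm_eq_abs, abs_mul]
        exact mul_le_mul (hK s hs) (h.abs_le hz hK1 hK hs).1 (abs_nonneg _) (by linarith))
      (left_mem_Icc.2 zero_le_one) ht1
    rw [hz, Real.norm_eq_abs, Real.norm_eq_abs, sub_zero, abs_of_nonneg ht.1] at this
    have h2 : K * Real.exp K * t ≤ K * Real.exp K * x := by gcongr; exact ht.2
    linarith [(_root_.abs_le.1 this).1]
  have hmono : MonotoneOn (fun t => y t - t / 2) (Icc 0 x) := by
    refine monotoneOn_of_hasDerivWithinAt_nonneg (f' := fun t => z t - 1 / 2) (convex_Icc 0 x)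
      ((h.continuousOn_fst.mono (Icc_subset_Icc_right hx.2)).sub (by fun_prop)) ?_ ?_
    · intro t ht
      rw [interior_Icc] at ht ⊢
      exact ((h.hasDerivAt_fst ⟨ht.1, ht.2.trans_le hx.2⟩).sub
        ((hasDerivAt_id t).div_const 2)).hasDerivWithinAt
    · intro t ht
      rw [interior_Icc] at ht
      linarith [hzx t (Ioo_subset_Icc_self ht)]
  have := hmono (left_mem_Icc.2 hx.1) (right_mem_Icc.2 hx.1) hx.1
  simp only [h.zero] at this
  linarith

/-- The integrand is the derivative of z w - y v, which vanishes at 0. -/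
lemma wronskian (ha : ContinuousOn a (Icc 0 1)) (hb : ContinuousOn b (Icc 0 1))
    (h : IsSolution a y z) (h' : IsSolution b w v) :
    ∫ x in (0 : ℝ)..1, (a x - b x) * (y x * w x) = z 1 * w 1 - y 1 * v 1 := by
  have hc := (h.continuousOn_snd.mul h'.continuousOn_fst).sub
    (h.continuousOn_fst.mul h'.continuousOn_snd)
  have := intervalIntegral.integral_eq_sub_of_hasDerivAt_of_le zero_le_one hc
    (f' := fun x => (a x - b x) * (y x * w x))
    (fun x hx => by
      convert ((h.hasDerivAt_snd hx).mul (h'.hasDerivAt_fst hx)).sub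
        ((h.hasDerivAt_fst hx).mul (h'.hasDerivAt_snd hx)) using 1
      ring)
    (ContinuousOn.intervalIntegrable_of_Icc zero_le_one
      ((ha.sub hb).mul (h.continuousOn_fst.mul h'.continuousOn_fst)))
  simpa [h.zero, h'.zero] using this

/-- The first derivative does not vanish where the solution does. -/
lemma deriv_ne_zero (ha : ContinuousOn a (Icc 0 1)) (h : IsSolution a y z) (hz : z 0 = 1)
    {x : ℝ} (hx : x ∈ Icc (0 : ℝ) 1) (hyx : y x = 0) : z x ≠ 0 := by
  intro hzx
  obtain ⟨K₀, hK₀⟩ := isCompact_Icc.exists_bound_of_continuousOn ha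
  simp only [Real.norm_eq_abs] at hK₀
  -- The derivative 2 y z (1 + a) of y² + z² is at least -(1 + K₀)(y² + z²), so the exponential
  -- weight makes it monotone. It equals 1 at 0 and so cannot vanish at x.
  have hmono : MonotoneOn (fun t => (y t ^ 2 + z t ^ 2) * Real.exp ((1 + K₀) * t)) (Icc 0 x) := by
    have hs : Icc 0 x ⊆ Icc (0 : ℝ) 1 := Icc_subset_Icc_right hx.2
    refine monotoneOn_of_hasDerivWithinAt_nonneg
      (f' := fun t => (2 * y t * z t * (1 + a t) + (1 + K₀) * (y t ^ 2 + z t ^ 2)) *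
        Real.exp ((1 + K₀) * t)) (convex_Icc 0 x) ?_ ?_ ?_
    · exact ((((h.continuousOn_fst.mono hs).pow 2).add ((h.continuousOn_snd.mono hs).pow 2))).mul
        (by fun_prop)
    · intro t ht
      rw [interior_Icc] at ht ⊢
      have ht' : t ∈ Ioo (0 : ℝ) 1 := ⟨ht.1, ht.2.trans_le hx.2⟩
      have := (((h.hasDerivAt_fst ht').pow 2).add ((h.hasDerivAt_snd ht').pow 2)).mul
        (((hasDerivAt_id t).const_mul (1 + K₀)).exp)
      refine HasDerivAt.hasDerivWithinAt (this.congr_deriv ?_)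
      simp
      ring
    · intro t ht
      rw [interior_Icc] at ht
      have hat := _root_.abs_le.1 (hK₀ t ⟨ht.1.le, ht.2.le.trans hx.2⟩)
      refine mul_nonneg ?_ (Real.exp_pos _).le
      have hab : |1 + a t| ≤ 1 + K₀ := _root_.abs_le.2 ⟨by linarith, by linarith⟩
      have h1 : |2 * y t * z t| ≤ y t ^ 2 + z t ^ 2 :=
        _root_.abs_le.2 ⟨by nlinarith [sq_nonneg (y t + z t)], by nlinarith [sq_nonneg (y t - z t)]⟩
      have h2 := mul_le_mul h1 hab (abs_nonneg _) (by positivity)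
      rw [← abs_mul] at h2
      linarith [neg_abs_le (2 * y t * z t * (1 + a t))]
  have := hmono (left_mem_Icc.2 hx.1) (right_mem_Icc.2 hx.1) hx.1
  simp only [h.zero, hz, hyx, hzx] at this
  norm_num at this

/-- Close to the left end point the solution is positive. -/
lemma exists_pos (ha : ContinuousOn a (Icc 0 1)) (h : IsSolution a y z) (hz : z 0 = 1)
    {x : ℝ} (hx : x ∈ Ioc (0 : ℝ) 1) : ∃ t ∈ Ioc 0 x, 0 < y t := by
  obtain ⟨K₀, hK₀⟩ := isCompact_Icc.exists_bound_of_continuousOn ha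
  simp only [Real.norm_eq_abs] at hK₀
  obtain ⟨K, hK1, hK⟩ : ∃ K : ℝ, 1 ≤ K ∧ ∀ x ∈ Icc (0 : ℝ) 1, |a x| ≤ K :=
    ⟨max 1 K₀, le_max_left _ _, fun x hx => (hK₀ x hx).trans (le_max_right _ _)⟩
  have hKe : 0 < K * Real.exp K := by positivity
  set t := min x (1 / (2 * (K * Real.exp K))) with ht
  have ht0 : 0 < t := lt_min hx.1 (by positivity)
  have htx : t ≤ x := min_le_left _ _
  refine ⟨t, ⟨ht0, htx⟩, ?_⟩
  have := h.half_le hz hK1 hK ⟨ht0.le, htx.trans hx.2⟩ (by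
    calc K * Real.exp K * t ≤ K * Real.exp K * (1 / (2 * (K * Real.exp K))) := by
          gcongr; exact min_le_right _ _
      _ = 1 / 2 := by field_simp)
  linarith

/-- Solutions for a non-negative coefficient have no zeros beyond the left end point. -/
lemma ne_zero_of_nonneg (ha0 : ∀ x ∈ Icc (0 : ℝ) 1, 0 ≤ a x) (ha : ContinuousOn a (Icc 0 1))
    (h : IsSolution a y z) (hz : z 0 = 1) {x : ℝ} (hx : x ∈ Ioc (0 : ℝ) 1) : y x ≠ 0 := by
  intro hyx
  -- Here (y z)' = z² + a y² ≥ 0, so y z ≥ 0 and y² is nondecreasing; it is positive somewhere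
  -- before x.
  have hmono : MonotoneOn (fun t => y t * z t) (Icc 0 1) := by
    refine monotoneOn_of_hasDerivWithinAt_nonneg
      (f' := fun t => z t * z t + y t * (a t * y t)) (convex_Icc 0 1)
      (h.continuousOn_fst.mul h.continuousOn_snd) ?_ ?_
    · intro t ht
      rw [interior_Icc] at ht ⊢
      exact ((h.hasDerivAt_fst ht).mul (h.hasDerivAt_snd ht)).hasDerivWithinAt
    · intro t ht
      have := ha0 t (interior_subset ht)
      nlinarith [mul_nonneg this (mul_self_nonneg (y t)), mul_self_nonneg (z t)]
  have hmono' : MonotoneOn (fun t => y t * y t) (Icc 0 1) := by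
    refine monotoneOn_of_hasDerivWithinAt_nonneg
      (f' := fun t => z t * y t + y t * z t) (convex_Icc 0 1)
      (h.continuousOn_fst.mul h.continuousOn_fst) ?_ ?_
    · intro t ht
      rw [interior_Icc] at ht ⊢
      exact ((h.hasDerivAt_fst ht).mul (h.hasDerivAt_fst ht)).hasDerivWithinAt
    · intro t ht
      have := hmono (left_mem_Icc.2 zero_le_one) (interior_subset ht) (interior_subset ht).1
      simp only [h.zero, zero_mul] at this
      linarith
  obtain ⟨t, ht, hyt⟩ := h.exists_pos ha hz hx
  have := hmono' ⟨ht.1.le, ht.2.trans hx.2⟩ (Ioc_subset_Icc_self hx) ht.2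
  simp only [hyx, zero_mul] at this
  nlinarith

end IsSolution

/-! ### Comparison with the sine. -/

lemma isSolution_sin :
    IsSolution (fun _ => -Real.pi ^ 2) (fun x => Real.sin (Real.pi * x) / Real.pi)
      (fun x => Real.cos (Real.pi * x)) where
  hasDeriv_fst x _ := by
    have h := (((hasDerivAt_id x).const_mul Real.pi).sin.div_const Real.pi).hasDerivWithinAt
      (s := Icc 0 1)
    have e : Real.cos (Real.pi * id x) * (Real.pi * 1) / Real.pi = Real.cos (Real.pi * x) := by
      simp [Real.pi_ne_zero]
    rwa [e] at h
  hasDeriv_snd x _ := by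
    have h := ((hasDerivAt_id x).const_mul Real.pi).cos.hasDerivWithinAt (s := Icc 0 1)
    have e : -Real.sin (Real.pi * id x) * (Real.pi * 1) =
        -Real.pi ^ 2 * (Real.sin (Real.pi * x) / Real.pi) := by
      have := Real.pi_ne_zero
      simp only [id]
      field_simp
    rwa [e] at h
  zero := by simp

lemma sin_pi_mul_nonneg {x : ℝ} (hx : x ∈ Icc (0 : ℝ) 1) : 0 ≤ Real.sin (Real.pi * x) :=
  Real.sin_nonneg_of_nonneg_of_le_pi (mul_nonneg Real.pi_pos.le hx.1)
    (mul_le_of_le_one_right Real.pi_pos.le hx.2)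

lemma sin_pi_mul_pos {x : ℝ} (hx : x ∈ Ioo (0 : ℝ) 1) : 0 < Real.sin (Real.pi * x) :=
  Real.sin_pos_of_pos_of_lt_pi (mul_pos Real.pi_pos hx.1)
    (mul_lt_of_lt_one_right Real.pi_pos hx.2)

lemma IsSolution.pos_of_ne_zero {a y z : ℝ → ℝ} (ha : ContinuousOn a (Icc 0 1))
    (h : IsSolution a y z) (hz : z 0 = 1) (hne : ∀ x ∈ Ioc (0 : ℝ) 1, y x ≠ 0)
    {x : ℝ} (hx : x ∈ Ioc (0 : ℝ) 1) : 0 < y x := by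
  by_contra! hle
  obtain ⟨t, ht, hyt⟩ := h.exists_pos ha hz hx
  obtain ⟨s, hs, hs0⟩ := intermediate_value_Icc' ht.2
    (h.continuousOn_fst.mono (Icc_subset_Icc ht.1.le hx.2)) ⟨hle, hyt.le⟩
  exact hne s ⟨ht.1.trans_le hs.1, hs.2.trans hx.2⟩ hs0

/-- For a large eigenvalue parameter the solution has a zero (Sturm comparison with the sine). -/
lemma IsSolution.exists_zero {a y z : ℝ → ℝ} (ha : ContinuousOn a (Icc 0 1))
    (h : IsSolution a y z) (hz : z 0 = 1) (hle : ∀ x ∈ Icc (0 : ℝ) 1, a x ≤ -Real.pi ^ 2) :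
    ∃ x ∈ Ioc (0 : ℝ) 1, y x = 0 := by
  by_contra! hne
  have hpos : ∀ x ∈ Ioc (0 : ℝ) 1, 0 < y x := fun x hx => h.pos_of_ne_zero ha hz hne hx
  -- The boundary terms reduce to y(1) > 0, because the sine vanishes at 1 with slope -1; the
  -- integrand is nonpositive.
  have hw := IsSolution.wronskian ha continuousOn_const h isSolution_sin
  simp only [mul_one, Real.sin_pi, zero_div, mul_zero, Real.cos_pi] at hw
  have hnonpos : ∫ x in (0 : ℝ)..1,
      (a x - -Real.pi ^ 2) * (y x * (Real.sin (Real.pi * x) / Real.pi)) ≤ 0 := by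
    rw [← neg_nonneg, ← intervalIntegral.integral_neg]
    refine intervalIntegral.integral_nonneg zero_le_one fun x hx => ?_
    have h1 : 0 ≤ y x := by
      rcases hx.1.eq_or_lt with h0 | h0
      · simp [← h0, h.zero]
      · exact (hpos x ⟨h0, hx.2⟩).le
    have h2 := hle x hx
    rw [← neg_mul]
    exact mul_nonneg (by linarith)
      (mul_nonneg h1 (div_nonneg (sin_pi_mul_nonneg hx) Real.pi_pos.le))
  linarith [hpos 1 (right_mem_Ioc.2 zero_lt_one)]

/-! ### The shooting method. -/

lemma two_lt_pi_sq : 2 < Real.pi ^ 2 := by nlinarith [Real.pi_gt_three]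

/-- A bound for the coefficients `q - μ`. -/
noncomputable def coeffBound : ℝ := Real.pi ^ 2 + 1

lemma one_le_coeffBound : 1 ≤ coeffBound := by
  unfold coeffBound; linarith [two_lt_pi_sq]

/-- The range of μ starts at -1 since the shooting argument lowers a parameter μ ≥ 0 by up to 1. -/
lemma abs_sub_le_coeffBound {t μ : ℝ} (ht : t ∈ Icc (0 : ℝ) 1)
    (hμ : μ ∈ Icc (-1) (Real.pi ^ 2 + 1)) : |t - μ| ≤ coeffBound := by
  unfold coeffBound
  exact abs_le.2 ⟨by linarith [ht.1, hμ.2], by linarith [ht.2, hμ.1, two_lt_pi_sq]⟩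

/-- The shooting method: there is a smallest `μ` for which the solution of the initial value
problem vanishes at `1`, and this solution is positive in between. -/
theorem exists_least_parameter {q : ℝ → ℝ} (hq : ContinuousOn q (Icc 0 1))
    (hq01 : MapsTo q (Icc 0 1) (Icc 0 1)) :
    ∃ μ ∈ Icc 0 (Real.pi ^ 2 + 1), ∃ y z : ℝ → ℝ, IsSolution (fun x => q x - μ) y z ∧ z 0 = 1 ∧
      y 1 = 0 ∧ (∀ x ∈ Ioo (0 : ℝ) 1, 0 < y x) ∧
      ∀ ν < μ, ∀ w v, IsSolution (fun x => q x - ν) w v → v 0 = 1 → w 1 ≠ 0 := by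
  have hc : ∀ μ : ℝ, ContinuousOn (fun x => q x - μ) (Icc 0 1) :=
    fun μ => hq.sub continuousOn_const
  choose Y Z hYZ hZ0 using fun μ : ℝ => exists_isSolution (hc μ)
  set M := Real.pi ^ 2 + 1 with hM
  have hMpos : 0 < M := by positivity
  set K := coeffBound
  have hK1 : 1 ≤ K := one_le_coeffBound
  have hK : ∀ μ ∈ Icc (-1) M, ∀ x ∈ Icc (0 : ℝ) 1, |q x - μ| ≤ K :=
    fun μ hμ x hx => abs_sub_le_coeffBound (hq01 hx) hμ
  have hKe : 0 < K * Real.exp K := by positivity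
  have hlip : ∀ μ ∈ Icc (-1) M, ∀ ν ∈ Icc (-1) M, ∀ x ∈ Icc (0 : ℝ) 1,
      |Y μ x - Y ν x| ≤ Real.exp K ^ 2 * |μ - ν| := fun μ hμ ν hν x hx =>
    (hYZ μ).abs_sub_le (hYZ ν) (hZ0 μ) (hZ0 ν) hK1 (hK μ hμ) (hK ν hν) (abs_nonneg _)
      (fun x _ => by rw [show q x - μ - (q x - ν) = -(μ - ν) by ring, abs_neg]) hx
  -- By `half_le`, no zero lies in (0, δ). This separates the zeros sought from the trivial one at
  -- 0, so that the set `T` of pairs (parameter, zero) is compact.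
  set δ := 1 / (2 * (K * Real.exp K)) with hδ
  have hδ0 : 0 < δ := by positivity
  have hsmall : ∀ μ ∈ Icc 0 M, ∀ x ∈ Ioc (0 : ℝ) 1, Y μ x = 0 → δ ≤ x := by
    intro μ hμ x hx hx0
    by_contra! hlt
    have := (hYZ μ).half_le (hZ0 μ) hK1 (hK μ ⟨by linarith [hμ.1], hμ.2⟩)
      (Ioc_subset_Icc_self hx) (by
        calc K * Real.exp K * x ≤ K * Real.exp K * δ := by gcongr
          _ = 1 / 2 := by rw [hδ]; field_simp)
    linarith [hx.1]
  have hcont : ContinuousOn (fun p : ℝ × ℝ => Y p.1 p.2) (Icc 0 M ×ˢ Icc δ 1) := by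
    refine continuousOn_prod_of_continuousOn_lipschitzOnWith _
      (⟨Real.exp K ^ 2, by positivity⟩) ?_ ?_
    · exact fun μ _ => (hYZ μ).continuousOn_fst.mono (Icc_subset_Icc_left hδ0.le)
    · intro x hx
      refine LipschitzOnWith.of_dist_le_mul fun μ hμ ν hν => ?_
      exact hlip μ ⟨by linarith [hμ.1], hμ.2⟩ ν ⟨by linarith [hν.1], hν.2⟩ x
        ⟨hδ0.le.trans hx.1, hx.2⟩
  have hcomp : IsCompact (Icc 0 M ×ˢ Icc δ 1) := isCompact_Icc.prod isCompact_Icc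
  set T : Set (ℝ × ℝ) := (Icc 0 M ×ˢ Icc δ 1) ∩ (fun p : ℝ × ℝ => Y p.1 p.2) ⁻¹' {0} with hT
  have hTc : IsCompact T := hcomp.of_isClosed_subset
    (hcont.preimage_isClosed_of_isClosed hcomp.isClosed isClosed_singleton) inter_subset_left
  have hTmem : ∀ μ ∈ Icc 0 M, ∀ x ∈ Ioc (0 : ℝ) 1, Y μ x = 0 → μ ∈ Prod.fst '' T :=
    fun μ hμ x hx hx0 => ⟨(μ, x), ⟨⟨hμ, hsmall μ hμ x hx hx0, hx.2⟩, hx0⟩, rfl⟩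
  have hTne : (Prod.fst '' T).Nonempty := by
    -- For μ = π² + 1 the coefficient q - μ is at most -π².
    obtain ⟨x, hx, hx0⟩ := (hYZ M).exists_zero (hc M) (hZ0 M)
      (fun x hx => by linarith [(hq01 hx).2])
    exact ⟨M, hTmem M ⟨hMpos.le, le_rfl⟩ x hx hx0⟩
  obtain ⟨μ, ⟨⟨_, x₀⟩, ⟨⟨hμ, hx₀⟩, hYx₀⟩, rfl⟩, hleast⟩ :=
    (hTc.image continuous_fst).exists_isLeast hTne
  simp only at hμ hx₀ hYx₀ hleast
  rename_i μ
  have hYx₀ : Y μ x₀ = 0 := hYx₀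
  have hbelow : ∀ ν < μ, ∀ x ∈ Ioc (0 : ℝ) 1, Y ν x ≠ 0 := by
    intro ν hν x hx hx0
    rcases lt_or_ge ν 0 with h0 | h0
    · exact (hYZ ν).ne_zero_of_nonneg (fun x hx => by linarith [(hq01 hx).1]) (hc ν) (hZ0 ν) hx hx0
    · exact absurd (hleast (hTmem ν ⟨h0, hν.le.trans hμ.2⟩ x hx hx0)) (not_le.2 hν)
  -- Below μ the solutions are positive on (0,1]. A negative value at μ would, by Lipschitz
  -- dependence, leave a nonpositive value at μ - η.
  have hnonneg : ∀ x ∈ Ioo (0 : ℝ) 1, 0 ≤ Y μ x := by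
    intro x hx
    by_contra! hneg
    set η := min 1 (-Y μ x / Real.exp K ^ 2) with hη
    have hη0 : 0 < η := lt_min one_pos (div_pos (by linarith) (by positivity))
    have hη1 : η ≤ 1 := min_le_left _ _
    have h1 := hlip (μ - η) ⟨by linarith [hμ.1], by linarith [hμ.2]⟩ μ
      ⟨by linarith [hμ.1], hμ.2⟩ x (Ioo_subset_Icc_self hx)
    have h2 : Real.exp K ^ 2 * |μ - η - μ| ≤ -Y μ x := by
      rw [show μ - η - μ = -η by ring, abs_neg, abs_of_pos hη0]
      calc Real.exp K ^ 2 * η ≤ Real.exp K ^ 2 * (-Y μ x / Real.exp K ^ 2) := by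
            gcongr; exact min_le_right _ _
        _ = -Y μ x := by field_simp
    have h3 := (hYZ (μ - η)).pos_of_ne_zero (hc _) (hZ0 _) (hbelow _ (by linarith))
      (Ioo_subset_Ioc_self hx)
    linarith [(abs_le.1 (h1.trans h2)).2]
  -- An interior zero of a nonnegative function is a minimum, so y and y' would vanish together.
  have hpos : ∀ x ∈ Ioo (0 : ℝ) 1, 0 < Y μ x := by
    intro x hx
    refine (hnonneg x hx).lt_of_ne' fun hx0 => ?_
    refine (hYZ μ).deriv_ne_zero (hc μ) (hZ0 μ) (Ioo_subset_Icc_self hx) hx0 ?_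
    refine IsLocalMin.hasDerivAt_eq_zero ?_ ((hYZ μ).hasDerivAt_fst hx)
    filter_upwards [Ioo_mem_nhds hx.1 hx.2] with t ht
    rw [hx0]
    exact hnonneg t ht
  have hx1 : x₀ = 1 := by
    by_contra hne
    exact (hpos x₀ ⟨hδ0.trans_le hx₀.1, hx₀.2.lt_of_ne hne⟩).ne' hYx₀
  refine ⟨μ, hμ, Y μ, Z μ, hYZ μ, hZ0 μ, hx1 ▸ hYx₀, hpos, fun ν hν w v hw hv hw1 => ?_⟩
  have := IsSolution.eqOn_smul (hc ν) (hYZ ν) (hZ0 ν) hw (right_mem_Icc.2 zero_le_one)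
  rw [hv, one_mul, hw1] at this
  exact hbelow ν hν 1 (right_mem_Ioc.2 zero_lt_one) this.symm

/-! ### The sup norm and the class `Q`. -/

section supNorm

variable {f : ℝ → ℝ}

lemma supNorm_nonneg (f : ℝ → ℝ) : 0 ≤ supNorm f := Real.iSup_nonneg fun _ => abs_nonneg _

lemma abs_le_supNorm (hf : ContinuousOn f (Icc 0 1)) {x : ℝ} (hx : x ∈ Icc (0 : ℝ) 1) :
    |f x| ≤ supNorm f := by
  obtain ⟨B, hB⟩ := isCompact_Icc.exists_bound_of_continuousOn hf
  exact le_ciSup (f := fun x : Icc (0 : ℝ) 1 => |f x|)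
    ⟨B, by rintro _ ⟨x, rfl⟩; exact hB x x.2⟩ ⟨x, hx⟩

lemma supNorm_le {B : ℝ} (h : ∀ x ∈ Icc (0 : ℝ) 1, |f x| ≤ B) : supNorm f ≤ B :=
  haveI : Nonempty (Icc (0 : ℝ) 1) := ⟨⟨0, by simp⟩⟩
  ciSup_le fun x => h x x.2

end supNorm

lemma Q.continuousOn {q : ℝ → ℝ} (hq : q ∈ Q) : ContinuousOn q (Icc 0 1) := hq.2.1.continuousOn

lemma const_half_mem_Q : (fun _ => 1 / 2 : ℝ → ℝ) ∈ Q := by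
  refine ⟨fun x _ => by norm_num, contDiffOn_const, fun i _ x _ => ?_⟩
  rw [iteratedDerivWithin_const]
  split_ifs <;> norm_num [abs_of_pos]

/-! ### Positive solutions and the smallest eigenvalue. -/

/-- A solution with `y'(0) = 1`, vanishing at both end points and positive in between. -/
structure IsPositiveSolution (a y z : ℝ → ℝ) : Prop extends IsSolution a y z where
  slope : z 0 = 1
  right : y 1 = 0
  pos : ∀ x ∈ Ioo (0 : ℝ) 1, 0 < y x

lemma isPositiveSolution_sin :
    IsPositiveSolution (fun _ => -Real.pi ^ 2) (fun x => Real.sin (Real.pi * x) / Real.pi)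
      (fun x => Real.cos (Real.pi * x)) where
  toIsSolution := isSolution_sin
  slope := by simp
  right := by simp
  pos x hx := div_pos (sin_pi_mul_pos hx) Real.pi_pos

/-- The boundary terms of the Wronskian vanish, while the integrand (a - b) y w would be positive.
This comparison replaces the min-max principle. -/
lemma IsPositiveSolution.not_forall_lt {a b y z w v : ℝ → ℝ} (ha : ContinuousOn a (Icc 0 1))
    (hb : ContinuousOn b (Icc 0 1)) (h : IsPositiveSolution a y z)
    (h' : IsPositiveSolution b w v) : ¬ ∀ x ∈ Ioo (0 : ℝ) 1, b x < a x := by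
  intro hlt
  have hw := IsSolution.wronskian ha hb h.toIsSolution h'.toIsSolution
  rw [h.right, h'.right, mul_zero, zero_mul, sub_zero] at hw
  refine (intervalIntegral.intervalIntegral_pos_of_pos_on ?_ (fun x hx => ?_) zero_lt_one).ne' hw
  · exact ContinuousOn.intervalIntegrable_of_Icc zero_le_one
      ((ha.sub hb).mul (h.continuousOn_fst.mul h'.continuousOn_fst))
  · exact mul_pos (sub_pos.2 (hlt x hx)) (mul_pos (h.pos x hx) (h'.pos x hx))

lemma IsSolution.isEigenfunction {q y z : ℝ → ℝ} {μ : ℝ} (hq : ContinuousOn q (Icc 0 1))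
    (h : IsSolution (fun x => q x - μ) y z) (h1 : y 1 = 0)
    (hne : ∃ x ∈ Icc (0 : ℝ) 1, y x ≠ 0) : IsEigenfunction q μ y where
  contDiffOn := by
    have hu : UniqueDiffOn ℝ (Icc (0 : ℝ) 1) := uniqueDiffOn_Icc zero_lt_one
    have e1 : EqOn (derivWithin y (Icc 0 1)) z (Icc 0 1) :=
      fun x hx => (h.hasDeriv_fst x hx).derivWithin (hu x hx)
    have e2 : EqOn (derivWithin z (Icc 0 1)) (fun x => (q x - μ) * y x) (Icc 0 1) :=
      fun x hx => (h.hasDeriv_snd x hx).derivWithin (hu x hx)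
    rw [show (2 : WithTop ℕ∞) = 1 + 1 by norm_num, contDiffOn_succ_iff_derivWithin hu]
    refine ⟨fun x hx => (h.hasDeriv_fst x hx).differentiableWithinAt, by simp, ?_⟩
    refine ContDiffOn.congr ?_ e1
    rw [contDiffOn_one_iff_derivWithin hu]
    exact ⟨fun x hx => (h.hasDeriv_snd x hx).differentiableWithinAt,
      ((hq.sub continuousOn_const).mul h.continuousOn_fst).congr e2⟩
  nonzero := hne
  equation x hx := by
    have e : deriv y =ᶠ[nhds x] z := by
      filter_upwards [Ioo_mem_nhds hx.1 hx.2] with t ht using (h.hasDerivAt_fst ht).deriv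
    rw [L, e.deriv_eq, (h.hasDerivAt_snd hx).deriv]
    ring
  left := h.zero
  right := h1

lemma IsEigenfunction.exists_isSolution {q u : ℝ → ℝ} {μ : ℝ} (hq : ContinuousOn q (Icc 0 1))
    (h : IsEigenfunction q μ u) : ∃ v, IsSolution (fun x => q x - μ) u v := by
  have hu : UniqueDiffOn ℝ (Icc (0 : ℝ) 1) := uniqueDiffOn_Icc zero_lt_one
  have h2 := h.contDiffOn
  rw [show (2 : WithTop ℕ∞) = 1 + 1 by norm_num, contDiffOn_succ_iff_derivWithin hu] at h2
  obtain ⟨hd, -, hv⟩ := h2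
  rw [contDiffOn_one_iff_derivWithin hu] at hv
  set v := derivWithin u (Icc 0 1) with hvdef
  have heq : EqOn (derivWithin v (Icc 0 1)) (fun x => (q x - μ) * u x) (Ioo 0 1) := by
    intro x hx
    have e : deriv u =ᶠ[nhds x] v := by
      filter_upwards [Ioo_mem_nhds hx.1 hx.2] with t ht
      exact (derivWithin_of_mem_nhds (Icc_mem_nhds ht.1 ht.2)).symm
    have := h.equation x hx
    rw [L, e.deriv_eq, ← derivWithin_of_mem_nhds (Icc_mem_nhds hx.1 hx.2)] at this
    simp only
    linarith
  -- The equation is imposed on (0,1) only; both sides are continuous on [0,1], so it extends to the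
  -- end points.
  have heq' : EqOn (derivWithin v (Icc 0 1)) (fun x => (q x - μ) * u x) (Icc 0 1) :=
    heq.of_subset_closure hv.2 ((hq.sub continuousOn_const).mul hd.continuousOn)
      Ioo_subset_Icc_self (by rw [closure_Ioo zero_ne_one])
  refine ⟨v, fun x hx => (hd x hx).hasDerivWithinAt, fun x hx => ?_, h.left⟩
  have := (hv.1 x hx).hasDerivWithinAt
  rwa [heq' hx] at this

/-- The smallest eigenvalue exists, is bounded, and has a positive eigenfunction. -/
lemma exists_isPositiveSolution {q : ℝ → ℝ} (hq : q ∈ Q) :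
    IsLeast (eigenvalues q) (smallestEigenvalue q) ∧
    smallestEigenvalue q ∈ Icc 0 (Real.pi ^ 2 + 1) ∧
    ∃ y z, IsPositiveSolution (fun x => q x - smallestEigenvalue q) y z := by
  obtain ⟨μ, hμ, y, z, h, hz, h1, hpos, hlow⟩ := exists_least_parameter (Q.continuousOn hq) hq.1
  have hleast : IsLeast (eigenvalues q) μ := by
    refine ⟨⟨y, h.isEigenfunction (Q.continuousOn hq) h1 ⟨1 / 2, by norm_num,
      (hpos (1 / 2) (by norm_num)).ne'⟩⟩, fun ν ⟨u, hu⟩ => ?_⟩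
    by_contra! hlt
    have hc : ContinuousOn (fun x => q x - ν) (Icc 0 1) :=
      (Q.continuousOn hq).sub continuousOn_const
    obtain ⟨v, hv⟩ := hu.exists_isSolution (Q.continuousOn hq)
    obtain ⟨w, w', hw, hw'⟩ := SturmLiouville.exists_isSolution hc
    -- An eigenfunction for ν is a multiple of w: either the factor is 0 and u vanishes, or w(1) =
    -- 0, which is excluded below μ.
    have hsm := fun x hx => IsSolution.eqOn_smul hc hw hw' hv (x := x) hx
    obtain ⟨x, hx, hux⟩ := hu.nonzero
    have h3 := hsm 1 (right_mem_Icc.2 zero_le_one)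
    rw [hu.right, eq_comm, mul_eq_zero] at h3
    rcases h3 with h3 | h3
    · exact hux (by rw [hsm x hx, h3, zero_mul])
    · exact hlow ν hlt w w' hw hw' h3
  have e : smallestEigenvalue q = μ := hleast.csInf_eq
  rw [e]
  exact ⟨hleast, hμ, y, z, ⟨h, hz, h1, hpos⟩⟩

/-- If λ(q) - λ(p) exceeded the sup norm, q - λ(q) would lie strictly below p - λ(p) throughout
(0,1), against `IsPositiveSolution.not_forall_lt`. -/
theorem abs_smallestEigenvalue_sub_le {q p : ℝ → ℝ} (hq : q ∈ Q) (hp : p ∈ Q) :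
    |smallestEigenvalue q - smallestEigenvalue p| ≤ supNorm (q - p) := by
  have aux : ∀ {q p : ℝ → ℝ}, q ∈ Q → p ∈ Q → ∀ {ε : ℝ},
      (∀ x ∈ Icc (0 : ℝ) 1, |q x - p x| ≤ ε) →
      smallestEigenvalue q - smallestEigenvalue p ≤ ε := by
    intro q p hq hp ε hε
    obtain ⟨-, -, y, z, h⟩ := exists_isPositiveSolution hq
    obtain ⟨-, -, w, v, h'⟩ := exists_isPositiveSolution hp
    by_contra! hlt
    refine IsPositiveSolution.not_forall_lt ((Q.continuousOn hp).sub continuousOn_const)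
      ((Q.continuousOn hq).sub continuousOn_const) h' h fun x hx => ?_
    have := (abs_le.1 (hε x (Ioo_subset_Icc_self hx))).2
    simp only [Pi.sub_apply]
    linarith
  have hb : ∀ x ∈ Icc (0 : ℝ) 1, |q x - p x| ≤ supNorm (q - p) := fun x hx =>
    abs_le_supNorm ((Q.continuousOn hq).sub (Q.continuousOn hp)) hx
  have h1 := aux hq hp hb
  have h2 := aux hp hq (fun x hx => by rw [abs_sub_comm]; exact hb x hx)
  exact abs_le.2 ⟨by linarith, h1⟩

lemma smallestEigenvalue_const_half :
    smallestEigenvalue (fun _ => 1 / 2) = Real.pi ^ 2 + 1 / 2 := by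
  obtain ⟨-, -, y, z, h⟩ := exists_isPositiveSolution const_half_mem_Q
  rcases lt_trichotomy (smallestEigenvalue (fun _ => 1 / 2)) (Real.pi ^ 2 + 1 / 2) with hl | hl | hl
  · exact absurd (fun x _ => by linarith) (h.not_forall_lt continuousOn_const
      continuousOn_const isPositiveSolution_sin)
  · exact hl
  · exact absurd (fun x _ => by linarith) (isPositiveSolution_sin.not_forall_lt
      continuousOn_const continuousOn_const h)

/-! ### Normalization, with bounds uniform over `Q`. -/

/-- The square of the `L₂` norm. -/
noncomputable def sqNorm (y : ℝ → ℝ) : ℝ := ∫ x in (0 : ℝ)..1, y x ^ 2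

lemma sqNorm_const_mul (c : ℝ) (y : ℝ → ℝ) : sqNorm (fun x => c * y x) = c ^ 2 * sqNorm y := by
  simp only [sqNorm, mul_pow, intervalIntegral.integral_const_mul]

/-- The interval on which solutions are bounded below by `x / 2`. -/
noncomputable def startLength : ℝ := 1 / (2 * (coeffBound * Real.exp coeffBound))

lemma startLength_pos : 0 < startLength := by
  have := one_le_coeffBound
  unfold startLength
  positivity

lemma startLength_le_one : startLength ≤ 1 := by
  have h1 := one_le_coeffBound
  have h2 := Real.add_one_le_exp coeffBound
  unfold startLength
  rw [div_le_one (by positivity)]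
  nlinarith

/-- A lower bound for the `L₂` norm of the positive solutions. -/
noncomputable def normBound : ℝ := Real.sqrt (startLength ^ 3 / 12)

lemma normBound_pos : 0 < normBound :=
  Real.sqrt_pos.2 (div_pos (pow_pos startLength_pos 3) (by norm_num))

section

variable {q p y z w v : ℝ → ℝ}

lemma abs_coeff_le (hq : q ∈ Q) {x : ℝ} (hx : x ∈ Icc (0 : ℝ) 1) :
    |q x - smallestEigenvalue q| ≤ coeffBound := by
  have h := (exists_isPositiveSolution hq).2.1
  exact abs_sub_le_coeffBound (hq.1 hx) ⟨by linarith [h.1], h.2⟩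

/-- Integrating y² ≥ x² / 4 over the initial interval gives `startLength ^ 3 / 12`. -/
lemma normBound_le (hq : q ∈ Q) (h : IsPositiveSolution (fun x => q x - smallestEigenvalue q) y z) :
    normBound ≤ Real.sqrt (sqNorm y) := by
  refine Real.sqrt_le_sqrt ?_
  have hc : ContinuousOn (fun x => y x ^ 2) (Icc 0 1) := h.continuousOn_fst.pow 2
  have hs := startLength_pos
  have hs1 := startLength_le_one
  have h1 : ∫ x in (0 : ℝ)..startLength, y x ^ 2 ≤ sqNorm y :=
    intervalIntegral.integral_mono_interval le_rfl hs.le hs1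
      (Filter.Eventually.of_forall fun x => sq_nonneg _)
      (hc.intervalIntegrable_of_Icc zero_le_one)
  have h2 : ∫ x in (0 : ℝ)..startLength, x ^ 2 / 4 ≤ ∫ x in (0 : ℝ)..startLength, y x ^ 2 := by
    refine intervalIntegral.integral_mono_on hs.le
      (Continuous.intervalIntegrable (by fun_prop) _ _)
      ((hc.mono (Icc_subset_Icc_right hs1)).intervalIntegrable_of_Icc hs.le) fun x hx => ?_
    have := h.half_le h.slope one_le_coeffBound (fun x hx => abs_coeff_le hq hx)
      ⟨hx.1, hx.2.trans hs1⟩ (by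
        have := one_le_coeffBound
        calc coeffBound * Real.exp coeffBound * x
            ≤ coeffBound * Real.exp coeffBound * startLength := by gcongr; exact hx.2
          _ = 1 / 2 := by unfold startLength; field_simp)
    nlinarith [hx.1]
  have h3 : ∫ x in (0 : ℝ)..startLength, x ^ 2 / 4 = startLength ^ 3 / 12 := by
    rw [intervalIntegral.integral_div, integral_pow]
    norm_num
    ring
  linarith

lemma sqNorm_pos (hq : q ∈ Q)
    (h : IsPositiveSolution (fun x => q x - smallestEigenvalue q) y z) : 0 < sqNorm y :=
  Real.sqrt_pos.1 (normBound_pos.trans_le (normBound_le hq h))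

/-- The normalized positive solution. -/
noncomputable def normalize (y : ℝ → ℝ) : ℝ → ℝ := fun x => (Real.sqrt (sqNorm y))⁻¹ * y x

lemma sqNorm_normalize (hy : 0 < sqNorm y) : sqNorm (normalize y) = 1 := by
  unfold normalize
  rw [sqNorm_const_mul, inv_pow, Real.sq_sqrt hy.le, inv_mul_cancel₀ hy.ne']

lemma isGroundState_normalize (hq : q ∈ Q)
    (h : IsPositiveSolution (fun x => q x - smallestEigenvalue q) y z) :
    IsGroundState q (normalize y) := by
  have hN := sqNorm_pos hq h
  refine ⟨(h.toIsSolution.const_mul (Real.sqrt (sqNorm y))⁻¹).isEigenfunction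
    (Q.continuousOn hq) (mul_eq_zero_of_right _ h.right) ⟨1 / 2, by norm_num, ?_⟩,
    sqNorm_normalize hN⟩
  exact (mul_pos (inv_pos.2 (Real.sqrt_pos.2 hN)) (h.pos (1 / 2) (by norm_num))).ne'

lemma IsGroundState.eqOn_or_eqOn_neg_normalize {u : ℝ → ℝ} (hq : q ∈ Q)
    (h : IsPositiveSolution (fun x => q x - smallestEigenvalue q) y z) (hu : IsGroundState q u) :
    EqOn u (normalize y) (Icc 0 1) ∨ EqOn u (-normalize y) (Icc 0 1) := by
  have hN := sqNorm_pos hq h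
  obtain ⟨v, hv⟩ := hu.1.exists_isSolution (Q.continuousOn hq)
  have hsm := fun x hx => IsSolution.eqOn_smul ((Q.continuousOn hq).sub continuousOn_const)
    h.toIsSolution h.slope hv (x := x) hx
  have h1 : v 0 ^ 2 * sqNorm y = 1 := by
    rw [← sqNorm_const_mul, ← hu.2]
    refine intervalIntegral.integral_congr fun x hx => ?_
    rw [uIcc_of_le zero_le_one] at hx
    simp only [hsm x hx]
  have h2 : v 0 ^ 2 = (Real.sqrt (sqNorm y))⁻¹ ^ 2 := by
    rw [inv_pow, Real.sq_sqrt hN.le]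
    field_simp
    exact h1
  rcases sq_eq_sq_iff_eq_or_eq_neg.1 h2 with h3 | h3
  · exact Or.inl fun x hx => by rw [hsm x hx, h3, normalize]
  · exact Or.inr fun x hx => by rw [hsm x hx, h3, Pi.neg_apply, normalize, neg_mul]

lemma abs_normalize_le (hq : q ∈ Q)
    (h : IsPositiveSolution (fun x => q x - smallestEigenvalue q) y z) {x : ℝ}
    (hx : x ∈ Icc (0 : ℝ) 1) : |normalize y x| ≤ normBound⁻¹ * Real.exp coeffBound := by
  have h1 := normBound_le hq h
  have h2 := normBound_pos
  rw [normalize, abs_mul, abs_of_nonneg (by positivity)]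
  exact mul_le_mul (inv_anti₀ h2 h1)
    (h.abs_le h.slope one_le_coeffBound (fun x hx => abs_coeff_le hq hx) hx).1
    (abs_nonneg _) (by positivity)

lemma abs_sqNorm_sub_le {E D : ℝ} (hy : ContinuousOn y (Icc 0 1)) (hw : ContinuousOn w (Icc 0 1))
    (hyE : ∀ x ∈ Icc (0 : ℝ) 1, |y x| ≤ E) (hwE : ∀ x ∈ Icc (0 : ℝ) 1, |w x| ≤ E)
    (hD : ∀ x ∈ Icc (0 : ℝ) 1, |y x - w x| ≤ D) : |sqNorm y - sqNorm w| ≤ 2 * E * D := by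
  have hi : ∀ {f : ℝ → ℝ}, ContinuousOn f (Icc 0 1) →
      IntervalIntegrable (fun x => f x ^ 2) MeasureTheory.volume 0 1 :=
    fun hf => (hf.pow 2).intervalIntegrable_of_Icc zero_le_one
  unfold sqNorm
  rw [← intervalIntegral.integral_sub (hi hy) (hi hw)]
  have := intervalIntegral.norm_integral_le_of_norm_le_const (a := 0) (b := 1)
    (f := fun x => y x ^ 2 - w x ^ 2) (C := 2 * E * D) fun x hx => by
      rw [uIoc_of_le zero_le_one] at hx
      have hx := Ioc_subset_Icc_self hx
      rw [Real.norm_eq_abs, sq_sub_sq, abs_mul]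
      refine mul_le_mul ((abs_add_le _ _).trans ?_) (hD x hx) (abs_nonneg _) ?_
      · linarith [hyE x hx, hwE x hx]
      · linarith [(abs_nonneg _).trans (hyE x hx)]
  simpa using this

/-! ### Lipschitz dependence of the ground state. -/

/-- The Lipschitz constant of the ground state. -/
noncomputable def lipConst : ℝ :=
  (normBound⁻¹ + Real.exp coeffBound ^ 2 * normBound⁻¹ ^ 3) * (2 * Real.exp coeffBound ^ 2)

lemma abs_normalize_sub_le (hq : q ∈ Q) (hp : p ∈ Q)
    (h : IsPositiveSolution (fun x => q x - smallestEigenvalue q) y z)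
    (h' : IsPositiveSolution (fun x => p x - smallestEigenvalue p) w v) {x : ℝ}
    (hx : x ∈ Icc (0 : ℝ) 1) :
    |normalize y x - normalize w x| ≤ lipConst * supNorm (q - p) := by
  set E := Real.exp coeffBound with hE
  set ε := supNorm (q - p) with hε
  set c := normBound with hc
  have hE0 : 0 < E := Real.exp_pos _
  have hc0 : 0 < c := normBound_pos
  have hyE := fun x hx => (h.abs_le h.slope one_le_coeffBound
    (fun x hx => abs_coeff_le hq hx) (x := x) hx).1
  have hwE := fun x hx => (h'.abs_le h'.slope one_le_coeffBound
    (fun x hx => abs_coeff_le hp hx) (x := x) hx).1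
  -- The factor 2 counts the change of the potential and the change of the eigenvalue.
  have hD : ∀ x ∈ Icc (0 : ℝ) 1, |y x - w x| ≤ E ^ 2 * (2 * ε) := fun x hx =>
    h.toIsSolution.abs_sub_le h'.toIsSolution h.slope h'.slope one_le_coeffBound
      (fun x hx => abs_coeff_le hq hx) (fun x hx => abs_coeff_le hp hx)
      (by linarith [supNorm_nonneg (q - p)])
      (fun x hx => by
        have h1 := abs_le_supNorm ((Q.continuousOn hq).sub (Q.continuousOn hp)) hx
        have h2 := abs_smallestEigenvalue_sub_le hq hp
        rw [Pi.sub_apply] at h1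
        rw [sub_sub_sub_comm]
        exact (_root_.abs_sub _ _).trans (by linarith)) hx
  set A := Real.sqrt (sqNorm y) with hA
  set B := Real.sqrt (sqNorm w) with hB
  have hcA : c ≤ A := normBound_le hq h
  have hcB : c ≤ B := normBound_le hp h'
  have hA0 : 0 < A := hc0.trans_le hcA
  have hB0 : 0 < B := hc0.trans_le hcB
  -- The square roots are controlled through A² - B² = (A + B)(A - B) and A + B ≥ 2c.
  have hAB : |B - A| ≤ E * (E ^ 2 * (2 * ε)) * c⁻¹ := by
    have h1 := abs_sqNorm_sub_le h.continuousOn_fst h'.continuousOn_fst hyE hwE hD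
    rw [← Real.sq_sqrt (sqNorm_pos hq h).le, ← Real.sq_sqrt (sqNorm_pos hp h').le, sq_sub_sq,
      abs_mul, abs_of_pos (add_pos hA0 hB0), abs_sub_comm] at h1
    rw [← div_eq_mul_inv, le_div_iff₀ hc0]
    have h2 : |B - A| * (2 * c) ≤ (A + B) * |B - A| := by
      rw [mul_comm]; gcongr; linarith
    linarith
  have e : normalize y x - normalize w x = A⁻¹ * (y x - w x) + A⁻¹ * B⁻¹ * w x * (B - A) := by
    simp only [normalize, ← hA, ← hB]
    field_simp
    ring
  have hAi : A⁻¹ ≤ c⁻¹ := inv_anti₀ hc0 hcA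
  have hBi : B⁻¹ ≤ c⁻¹ := inv_anti₀ hc0 hcB
  rw [e]
  refine (abs_add_le _ _).trans ?_
  rw [abs_mul, abs_mul, abs_mul, abs_mul, abs_of_pos (inv_pos.2 hA0), abs_of_pos (inv_pos.2 hB0)]
  calc A⁻¹ * |y x - w x| + A⁻¹ * B⁻¹ * |w x| * |B - A|
      ≤ c⁻¹ * (E ^ 2 * (2 * ε)) + c⁻¹ * c⁻¹ * E * (E * (E ^ 2 * (2 * ε)) * c⁻¹) := by
        gcongr
        · exact hD x hx
        · exact hwE x hx
    _ = lipConst * ε := by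
        unfold lipConst
        ring

/-! ### First order expansion of the eigenvalue. -/

/-- The constant of the second order error term. -/
noncomputable def quadConst : ℝ := 2 * (normBound⁻¹ * Real.exp coeffBound) * lipConst

lemma abs_smallestEigenvalue_sub_integral_le (hq : q ∈ Q) (hp : p ∈ Q)
    (h : IsPositiveSolution (fun x => q x - smallestEigenvalue q) y z)
    (h' : IsPositiveSolution (fun x => p x - smallestEigenvalue p) w v) :
    |smallestEigenvalue q - (smallestEigenvalue p +
      ∫ x in (0 : ℝ)..1, (q x - p x) * normalize w x ^ 2)| ≤ quadConst * supNorm (q - p) ^ 2 := by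
  have hcq := Q.continuousOn hq
  have hcp := Q.continuousOn hp
  have hs := h.toIsSolution.const_mul (Real.sqrt (sqNorm y))⁻¹
  have hs' := h'.toIsSolution.const_mul (Real.sqrt (sqNorm w))⁻¹
  have hcu : ContinuousOn (normalize y) (Icc 0 1) := hs.continuousOn_fst
  have hcw : ContinuousOn (normalize w) (Icc 0 1) := hs'.continuousOn_fst
  have hw : ∫ x in (0 : ℝ)..1, (q x - smallestEigenvalue q - (p x - smallestEigenvalue p)) *
      (normalize y x * normalize w x) = 0 := by
    have := IsSolution.wronskian (hcq.sub continuousOn_const) (hcp.sub continuousOn_const) hs hs'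
    rw [h.right, h'.right] at this
    simpa [normalize] using this
  set Δ := smallestEigenvalue q - smallestEigenvalue p with hΔ
  have hone : ∫ x in (0 : ℝ)..1, normalize w x ^ 2 = 1 := sqNorm_normalize (sqNorm_pos hp h')
  have i1 : IntervalIntegrable (fun x => Δ * normalize w x ^ 2) MeasureTheory.volume 0 1 :=
    (continuousOn_const.mul (hcw.pow 2)).intervalIntegrable_of_Icc zero_le_one
  have i2 : IntervalIntegrable (fun x => (q x - p x) * normalize w x ^ 2)
      MeasureTheory.volume 0 1 :=
    ((hcq.sub hcp).mul (hcw.pow 2)).intervalIntegrable_of_Icc zero_le_one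
  have i3 : IntervalIntegrable (fun x => (q x - smallestEigenvalue q -
      (p x - smallestEigenvalue p)) * (normalize y x * normalize w x)) MeasureTheory.volume 0 1 :=
    (((hcq.sub continuousOn_const).sub (hcp.sub continuousOn_const)).mul
      (hcu.mul hcw)).intervalIntegrable_of_Icc zero_le_one
  -- Adding the vanishing integral `hw` turns the weight w² into w (w - u), with u the normalized y.
  -- Both Δ - (q - p) and w - u are of first order, hence the quadratic bound.
  have key : smallestEigenvalue q - (smallestEigenvalue p +
      ∫ x in (0 : ℝ)..1, (q x - p x) * normalize w x ^ 2) =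
      ∫ x in (0 : ℝ)..1, (Δ - (q x - p x)) * normalize w x * (normalize w x - normalize y x) := by
    have e1 : ∫ x in (0 : ℝ)..1, Δ * normalize w x ^ 2 = Δ := by
      rw [intervalIntegral.integral_const_mul, hone, mul_one]
    calc _ = (∫ x in (0 : ℝ)..1, Δ * normalize w x ^ 2) -
          (∫ x in (0 : ℝ)..1, (q x - p x) * normalize w x ^ 2) +
          ∫ x in (0 : ℝ)..1, (q x - smallestEigenvalue q - (p x - smallestEigenvalue p)) *
            (normalize y x * normalize w x) := by rw [e1, hw, hΔ]; ring
      _ = _ := by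
        rw [← intervalIntegral.integral_sub i1 i2, ← intervalIntegral.integral_add (i1.sub i2) i3]
        refine intervalIntegral.integral_congr fun x _ => ?_
        simp only [hΔ]
        ring
  rw [key]
  have := intervalIntegral.norm_integral_le_of_norm_le_const (a := 0) (b := 1)
    (f := fun x => (Δ - (q x - p x)) * normalize w x * (normalize w x - normalize y x))
    (C := quadConst * supNorm (q - p) ^ 2) fun x hx => by
      rw [uIoc_of_le zero_le_one] at hx
      have hx := Ioc_subset_Icc_self hx
      have h1 := abs_le_supNorm (hcq.sub hcp) hx
      rw [Pi.sub_apply] at h1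
      have h2 := abs_smallestEigenvalue_sub_le hq hp
      have h3 := abs_normalize_sub_le hq hp h h' hx
      have h4 := abs_normalize_le hp h' hx
      have h5 : |Δ - (q x - p x)| ≤ 2 * supNorm (q - p) :=
        (_root_.abs_sub _ _).trans (by linarith)
      rw [abs_sub_comm] at h3
      rw [Real.norm_eq_abs, abs_mul, abs_mul]
      have h6 := mul_le_mul h5 h4 (abs_nonneg _) (by linarith [supNorm_nonneg (q - p)])
      calc _ ≤ 2 * supNorm (q - p) * (normBound⁻¹ * Real.exp coeffBound) *
            (lipConst * supNorm (q - p)) :=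
            mul_le_mul h6 h3 (abs_nonneg _) ((by positivity : (0 : ℝ) ≤ _).trans h6)
        _ = _ := by unfold quadConst; ring
  simpa using this

end

/-! ### The constant potential 1/2 and the conclusion. -/

lemma isGroundState_const_half :
    IsGroundState (fun _ => 1 / 2)
      (fun x => Real.sqrt 2 * Real.pi * (Real.sin (Real.pi * x) / Real.pi)) := by
  have h := isSolution_sin.const_mul (Real.sqrt 2 * Real.pi)
  have hpi := Real.pi_ne_zero
  have e : (fun _ => -Real.pi ^ 2 : ℝ → ℝ) =
      fun x => (fun _ => 1 / 2 : ℝ → ℝ) x - smallestEigenvalue (fun _ => 1 / 2) := by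
    rw [smallestEigenvalue_const_half]
    funext x
    ring
  rw [e] at h
  refine ⟨h.isEigenfunction continuousOn_const (by simp) ⟨1 / 2, by norm_num, ?_⟩, ?_⟩
  · have := sin_pi_mul_pos (x := 1 / 2) (by norm_num)
    have := Real.pi_pos
    positivity
  · have e2 : ∀ x : ℝ, (Real.sqrt 2 * Real.pi * (Real.sin (Real.pi * x) / Real.pi)) ^ 2 =
        2 * Real.sin (Real.pi * x) ^ 2 := by
      intro x
      rw [show Real.sqrt 2 * Real.pi * (Real.sin (Real.pi * x) / Real.pi) =
        Real.sqrt 2 * Real.sin (Real.pi * x) by field_simp, mul_pow, Real.sq_sqrt (by norm_num)]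
    simp only [e2, intervalIntegral.integral_const_mul]
    rw [intervalIntegral.integral_comp_mul_left (fun x => Real.sin x ^ 2) hpi]
    simp [integral_sin_sq]
    field_simp

end SturmLiouville

theorem mainTheorem1 :
    -- `λ(q)` is indeed a smallest eigenvalue
    (∀ q ∈ SturmLiouville.Q,
      IsLeast (SturmLiouville.eigenvalues q) (SturmLiouville.smallestEigenvalue q)) ∧
    -- normalized eigenfunctions for `λ(q)` exist and are unique up to the sign
    (∀ q ∈ SturmLiouville.Q,
      (∃ u, SturmLiouville.IsGroundState q u) ∧
      ∀ u v, SturmLiouville.IsGroundState q u → SturmLiouville.IsGroundState q v →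
        Set.EqOn u v (Set.Icc 0 1) ∨ Set.EqOn u (-v) (Set.Icc 0 1)) ∧
    -- perturbation of the eigenvalue
    (∀ q ∈ SturmLiouville.Q, ∀ p ∈ SturmLiouville.Q,
      |SturmLiouville.smallestEigenvalue q - SturmLiouville.smallestEigenvalue p| ≤
        SturmLiouville.supNorm (q - p)) ∧
    -- perturbation of the eigenfunction, for a suitable choice of the signs
    (∃ u : (ℝ → ℝ) → (ℝ → ℝ),
      (∀ q ∈ SturmLiouville.Q, SturmLiouville.IsGroundState q (u q)) ∧
      ∃ C : ℝ, ∀ q ∈ SturmLiouville.Q, ∀ p ∈ SturmLiouville.Q,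
        SturmLiouville.supNorm (u q - u p) ≤ C * SturmLiouville.supNorm (q - p)) ∧
    -- first order expansion of the eigenvalue
    (∃ C : ℝ, ∀ q ∈ SturmLiouville.Q, ∀ p ∈ SturmLiouville.Q,
      ∀ v, SturmLiouville.IsGroundState p v →
        |SturmLiouville.smallestEigenvalue q -
            (SturmLiouville.smallestEigenvalue p +
              ∫ x in (0 : ℝ)..1, (q x - p x) * v x ^ 2)| ≤
          C * SturmLiouville.supNorm (q - p) ^ 2) ∧
    -- the special case of the constant function `1/2`
    (∃ C : ℝ, ∀ q ∈ SturmLiouville.Q,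
      |SturmLiouville.smallestEigenvalue q -
          (Real.pi ^ 2 + 1 / 2 +
            2 * ∫ x in (0 : ℝ)..1, (q x - 1 / 2) * Real.sin (Real.pi * x) ^ 2)| ≤
        C * SturmLiouville.supNorm (fun x => q x - 1 / 2) ^ 2) := by
  open SturmLiouville in
  have hex : ∀ q ∈ Q, ∃ y z, IsPositiveSolution (fun x => q x - smallestEigenvalue q) y z :=
    fun q hq => (exists_isPositiveSolution hq).2.2
  choose! y z h using hex
  have hexp : ∀ q ∈ Q, ∀ p ∈ Q, ∀ v, IsGroundState p v →
      |smallestEigenvalue q -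
          (smallestEigenvalue p + ∫ x in (0 : ℝ)..1, (q x - p x) * v x ^ 2)| ≤
        quadConst * supNorm (q - p) ^ 2 := by
    intro q hq p hp v hv
    -- The sign of v disappears in the square, so v may be replaced by the positive ground state.
    have e : ∫ x in (0 : ℝ)..1, (q x - p x) * v x ^ 2 =
        ∫ x in (0 : ℝ)..1, (q x - p x) * normalize (y p) x ^ 2 := by
      refine intervalIntegral.integral_congr fun x hx => ?_
      rw [Set.uIcc_of_le zero_le_one] at hx
      rcases hv.eqOn_or_eqOn_neg_normalize hp (h p hp) with h1 | h1 <;> simp [h1 hx]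
    rw [e]
    exact abs_smallestEigenvalue_sub_integral_le hq hp (h q hq) (h p hp)
  refine ⟨fun q hq => (exists_isPositiveSolution hq).1, fun q hq =>
    ⟨⟨_, isGroundState_normalize hq (h q hq)⟩, fun u v hu hv => ?_⟩,
    fun q hq p hp => abs_smallestEigenvalue_sub_le hq hp,
    ⟨fun q => normalize (y q), fun q hq => isGroundState_normalize hq (h q hq), lipConst,
      fun q hq p hp => supNorm_le fun x hx =>
        abs_normalize_sub_le hq hp (h q hq) (h p hp) hx⟩,
    ⟨quadConst, hexp⟩, ⟨quadConst, fun q hq => ?_⟩⟩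
  · rcases hu.eqOn_or_eqOn_neg_normalize hq (h q hq) with h1 | h1 <;>
      rcases hv.eqOn_or_eqOn_neg_normalize hq (h q hq) with h2 | h2
    · exact Or.inl fun x hx => by rw [h1 hx, h2 hx]
    · exact Or.inr fun x hx => by simp [h1 hx, h2 hx]
    · exact Or.inr fun x hx => by simp [h1 hx, h2 hx]
    · exact Or.inl fun x hx => by rw [h1 hx, h2 hx]
  · have := hexp q hq _ const_half_mem_Q _ isGroundState_const_half
    rw [smallestEigenvalue_const_half] at this
    have e : ∫ x in (0 : ℝ)..1, (q x - 1 / 2) *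
          (Real.sqrt 2 * Real.pi * (Real.sin (Real.pi * x) / Real.pi)) ^ 2 =
        2 * ∫ x in (0 : ℝ)..1, (q x - 1 / 2) * Real.sin (Real.pi * x) ^ 2 := by
      rw [← intervalIntegral.integral_const_mul]
      refine intervalIntegral.integral_congr fun x _ => ?_
      have hpi := Real.pi_ne_zero
      have h2 : Real.sqrt 2 ^ 2 = 2 := Real.sq_sqrt (by norm_num)
      field_simp
      rw [h2]
      ring
    rw [e] at this
    exact this
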